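/- Fix a prime $p$. Let $\mathbb{Z}_{(p)}\subset\mathbb{Q}$ be the localization of $\mathbb{Z}$ at $p\mathbb{Z}$, let $\mathbb{Z}_p$ be the ring of $p$-adic integers, with field of fractions $\mathbb{Q}_p$, and let $\mathrm{Int}(\mathbb{Z}_{(p)})=\{f\in\mathbb{Q}[X]\mid f(\mathbb{Z}_{(p)})\subseteq\mathbb{Z}_{(p)}\}$. Let $\mathcal{R}_p$ be the set of polynomial overrings of $\mathrm{Int}(\mathbb{Z}_{(p)})$, that is, of rings $R$ with $\mathrm{Int}(\mathbb{Z}_{(p)})\subseteq R\subseteq\mathbb{Q}[X]$, and let $\mathcal{F}(\mathbb{Z}_p)$ be the family of all subsets of $\mathbb{Z}_p$ (including $\emptyset$) that are closed for the $p$-adic topology. For $\alpha\in\mathbb{Z}_p$ let $\mathfrak{M}_{p,\alpha}=\{f\in\mathrm{Int}(\mathbb{Z}_{(p)})\mid f(\alpha)\in p\mathbb{Z}_p\}$, an ideal of $\mathrm{Int}(\mathbb{Z}_{(p)})$. For $R\in\mathcal{R}_p$ let $$Z_p(R)=\{\alpha\in\mathbb{Z}_p\mid \mathfrak{M}_{p,\alpha}R\subsetneq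 R\},$$ where $\mathfrak{M}_{p,\alpha}R$ is the ideal of $R$ generated by $\mathfrak{M}_{p,\alpha}$, and for $E\subseteq\mathbb{Z}_p$ let $$\mathrm{Int}_{\mathbb{Q}}(E,\mathbb{Z}_p)=\{f\in\mathbb{Q}[X]\mid f(E)\subseteq\mathbb{Z}_p\}.$$ Then $R\mapsto Z_p(R)$ is a well-defined map $\varphi_p:\mathcal{R}_p\to\mathcal{F}(\mathbb{Z}_p)$, $F\mapsto\mathrm{Int}_{\mathbb{Q}}(F,\mathbb{Z}_p)$ is a well-defined map $\psi_p:\mathcal{F}(\mathbb{Z}_p)\to\mathcal{R}_p$, both maps reverse inclusions, and they are inverse to each other: $\psi_p\circ\varphi_p=\mathrm{id}$ and $\varphi_p\circ\psi_p=\mathrm{id}$. In particular, $R=\mathrm{Int}_{\mathbb{Q}}(Z_p(R),\mathbb{Z}_p)$ for every $R\in\mathcal{R}_p$. -/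

import Mathlib

namespace PadicIntPoly

open Polynomial

/-- `ℤ_(p)`, the localization of `ℤ` at the prime ideal `pℤ`, as a subring of `ℚ`:
the fractions `a / s` with `a, s ∈ ℤ` and `p ∤ s`. -/
def ZLoc (p : ℕ) [hp : Fact p.Prime] : Subring ℚ where
  carrier := {x | ∃ a s : ℤ, ¬ (p : ℤ) ∣ s ∧ x = a / s}
  zero_mem' := ⟨0, 1, fun h => hp.out.one_lt.ne' (Nat.dvd_one.mp (by exact_mod_cast h)), by simp⟩
  one_mem' := ⟨1, 1, fun h => hp.out.one_lt.ne' (Nat.dvd_one.mp (by exact_mod_cast h)), by simp⟩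
  add_mem' := by
    rintro _ _ ⟨a, s, hs, rfl⟩ ⟨b, t, ht, rfl⟩
    refine ⟨a * t + s * b, s * t, fun h => ?_, ?_⟩
    · exact ((Nat.prime_iff_prime_int.mp hp.out).dvd_or_dvd h).elim hs ht
    · have hs0 : (s : ℚ) ≠ 0 := by rintro h; exact hs (by simp [Int.cast_eq_zero.mp h])
      have ht0 : (t : ℚ) ≠ 0 := by rintro h; exact ht (by simp [Int.cast_eq_zero.mp h])
      push_cast
      rw [div_add_div _ _ hs0 ht0]
  neg_mem' := by
    rintro _ ⟨a, s, hs, rfl⟩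
    exact ⟨-a, s, hs, by push_cast; ring⟩
  mul_mem' := by
    rintro _ _ ⟨a, s, hs, rfl⟩ ⟨b, t, ht, rfl⟩
    refine ⟨a * b, s * t, fun h => ?_, ?_⟩
    · exact ((Nat.prime_iff_prime_int.mp hp.out).dvd_or_dvd h).elim hs ht
    · push_cast
      rw [div_mul_div_comm]

/-- `Int(ℤ_(p)) = {f ∈ ℚ[X] | f(ℤ_(p)) ⊆ ℤ_(p)}`. -/
def IntZLoc (p : ℕ) [Fact p.Prime] : Subring ℚ[X] where
  carrier := {f | ∀ x ∈ ZLoc p, f.eval x ∈ ZLoc p}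
  zero_mem' x _ := by simp [zero_mem]
  one_mem' x _ := by simp [one_mem]
  add_mem' hf hg x hx := by rw [eval_add]; exact add_mem (hf x hx) (hg x hx)
  neg_mem' hf x hx := by rw [eval_neg]; exact neg_mem (hf x hx)
  mul_mem' hf hg x hx := by rw [eval_mul]; exact mul_mem (hf x hx) (hg x hx)

/-- `Int_ℚ(E, ℤ_p) = {f ∈ ℚ[X] | f(E) ⊆ ℤ_p}` for a subset `E` of `ℤ_p`; the value `f(α)` is
computed in `ℚ_p`. -/
def IntQ (p : ℕ) [Fact p.Prime] (E : Set ℤ_[p]) : Subring ℚ[X] where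
  carrier := {f | ∀ α ∈ E, aeval (α : ℚ_[p]) f ∈ PadicInt.subring p}
  zero_mem' x _ := by simp [zero_mem]
  one_mem' x _ := by simp [one_mem]
  add_mem' hf hg x hx := by rw [map_add]; exact add_mem (hf x hx) (hg x hx)
  neg_mem' hf x hx := by rw [map_neg]; exact neg_mem (hf x hx)
  mul_mem' hf hg x hx := by rw [map_mul]; exact mul_mem (hf x hx) (hg x hx)

/-- A polynomial of `Int(ℤ_(p))` takes values in `ℤ_p` on all of `ℤ_p`. -/
theorem norm_aeval_le_one (p : ℕ) [hp : Fact p.Prime] {f : ℚ[X]} (hf : f ∈ IntZLoc p)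
    (α : ℤ_[p]) : ‖aeval (α : ℚ_[p]) f‖ ≤ 1 := by
  have hc : Continuous fun α : ℤ_[p] => ‖aeval (α : ℚ_[p]) f‖ := by
    have h1 : Continuous fun x : ℚ_[p] => aeval x f := f.continuous_aeval
    exact (h1.comp continuous_subtype_val).norm
  have hcl : IsClosed {α : ℤ_[p] | ‖aeval (α : ℚ_[p]) f‖ ≤ 1} := isClosed_le hc continuous_const
  have hsub : Set.range (Nat.cast : ℕ → ℤ_[p]) ⊆ {α : ℤ_[p] | ‖aeval (α : ℚ_[p]) f‖ ≤ 1} := by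
    rintro _ ⟨n, rfl⟩
    obtain ⟨a, s, hs, has⟩ := hf (n : ℚ) (natCast_mem _ n)
    have h2 : aeval ((n : ℤ_[p]) : ℚ_[p]) f = algebraMap ℚ ℚ_[p] (f.eval (n : ℚ)) := by
      rw [← aeval_algebraMap_apply_eq_algebraMap_eval]
      simp
    have h3 : ‖(s : ℚ_[p])‖ = 1 :=
      le_antisymm (Padic.norm_int_le_one s)
        (not_lt.mp fun h => hs (Padic.norm_intCast_lt_one_iff.mp h))
    show ‖aeval ((n : ℤ_[p]) : ℚ_[p]) f‖ ≤ 1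
    rw [h2, has, map_div₀, map_intCast, map_intCast, norm_div, h3, div_one]
    exact Padic.norm_int_le_one a
  have hd : closure (Set.range (Nat.cast : ℕ → ℤ_[p])) = Set.univ :=
    PadicInt.denseRange_natCast.closure_range
  exact (hcl.closure_subset_iff.mpr hsub) (hd ▸ Set.mem_univ α)

/-- The ideal `𝔐_{p,α} = {f ∈ Int(ℤ_(p)) | f(α) ∈ pℤ_p}` of `Int(ℤ_(p))`, for `α ∈ ℤ_p`. -/
def maxIdeal (p : ℕ) [Fact p.Prime] (α : ℤ_[p]) : Ideal (IntZLoc p) where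
  carrier := {f | ∃ b : ℤ_[p], aeval (α : ℚ_[p]) (f : ℚ[X]) = p * b}
  zero_mem' := ⟨0, by simp⟩
  add_mem' := by
    rintro f g ⟨b, hb⟩ ⟨c, hc⟩
    exact ⟨b + c, by simp [hb, hc, mul_add]⟩
  smul_mem' := by
    rintro c f ⟨b, hb⟩
    obtain ⟨z, hz⟩ : ∃ z : ℤ_[p], (z : ℚ_[p]) = aeval (α : ℚ_[p]) (c : ℚ[X]) :=
      ⟨⟨_, norm_aeval_le_one p c.2 α⟩, rfl⟩
    refine ⟨z * b, ?_⟩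
    rw [smul_eq_mul, Subring.coe_mul, map_mul, hb, PadicInt.coe_mul, hz, mul_left_comm]

/-- The set `𝓡_p` of polynomial overrings of `Int(ℤ_(p))`: the rings `R` with
`Int(ℤ_(p)) ⊆ R ⊆ ℚ[X]`, ordered by inclusion. -/
abbrev PolyOverring (p : ℕ) [Fact p.Prime] : Type :=
  {R : Subring ℚ[X] // IntZLoc p ≤ R}

/-- `Z_p(R) = {α ∈ ℤ_p | 𝔐_{p,α} R ⊊ R}`, where `𝔐_{p,α} R` is the ideal of `R` generated by
`𝔐_{p,α}`. -/
def Zp (p : ℕ) [Fact p.Prime] (R : PolyOverring p) : Set ℤ_[p] :=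
  {α | (maxIdeal p α).map (Subring.inclusion R.2) < ⊤}

end PadicIntPoly

namespace PadicIntPoly

open Polynomial

variable {p : ℕ} [hp : Fact p.Prime]

/-! The key is that `α ∈ Zp p R` exactly when every `f ∈ R` is integral at `α` (`mem_Zp_iff`). By
Mahler's theorem `Int(ℤ_(p))` is dense in `C(ℤ_p, ℤ_p)`, so each `f ∈ ℚ[X]` has an integer-valued
`h` with `|h(α)| = min(1, 1/|f(α)|)` everywhere (`exists_mem_IntZLoc_norm_eq`); then `h f` is
integer-valued. If `f ∈ R` and `|f(α)| > 1`, then `h ∈ 𝔐_{p,α}` while `h f` is a unit at `α`, which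
forces `𝔐_{p,α} R = R`. The same `h` recovers `R` from `Zp p R` by way of a conductor ideal
(`mem_of_norm_aeval_le_one`). Density also separates a closed set from a point outside it
(`exists_mem_IntQ_one_lt`). -/

theorem continuous_aeval_coe (f : ℚ[X]) : Continuous fun α : ℤ_[p] => aeval (α : ℚ_[p]) f :=
  f.continuous_aeval.comp continuous_subtype_val

theorem mem_ZLoc_of_norm_le_one {x : ℚ} (hx : ‖(x : ℚ_[p])‖ ≤ 1) : x ∈ ZLoc p := by
  refine ⟨x.num, x.den, fun h => ?_, by simp [Rat.num_div_den]⟩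
  have h1 := PadicInt.isUnit_iff.mp (PadicInt.isUnit_den x hx)
  have h2 : ‖((x.den : ℤ) : ℤ_[p])‖ < 1 := (PadicInt.norm_int_lt_one_iff_dvd _).mpr h
  rw [Int.cast_natCast, h1] at h2
  exact lt_irrefl _ h2

theorem norm_le_one_of_mem_ZLoc {x : ℚ} (hx : x ∈ ZLoc p) : ‖(x : ℚ_[p])‖ ≤ 1 := by
  obtain ⟨a, s, hs, rfl⟩ := hx
  have h3 : ‖(s : ℚ_[p])‖ = 1 :=
    le_antisymm (Padic.norm_int_le_one s)
      (not_lt.mp fun h => hs (Padic.norm_intCast_lt_one_iff.mp h))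
  push_cast
  rw [norm_div, h3, div_one]
  exact Padic.norm_int_le_one a

theorem mem_IntZLoc_iff {f : ℚ[X]} :
    f ∈ IntZLoc p ↔ ∀ α : ℤ_[p], ‖aeval (α : ℚ_[p]) f‖ ≤ 1 := by
  refine ⟨fun hf α => norm_aeval_le_one p hf α, fun h x hx => mem_ZLoc_of_norm_le_one ?_⟩
  have h1 := h ⟨(x : ℚ_[p]), norm_le_one_of_mem_ZLoc hx⟩
  have h2 : aeval (x : ℚ_[p]) f = ((f.eval x : ℚ) : ℚ_[p]) := by
    have := aeval_algebraMap_apply_eq_algebraMap_eval (A := ℚ_[p]) x f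
    simpa using this
  rwa [← h2]

theorem exists_eq_p_mul_iff {y : ℚ_[p]} : (∃ b : ℤ_[p], y = p * b) ↔ ‖y‖ < 1 := by
  constructor
  · rintro ⟨b, rfl⟩
    have : ‖((p * b : ℤ_[p]))‖ < 1 := (PadicInt.norm_lt_one_iff_dvd _).mpr (dvd_mul_right _ _)
    rwa [PadicInt.norm_def, PadicInt.coe_mul, PadicInt.coe_natCast] at this
  · intro h
    let z : ℤ_[p] := ⟨y, h.le⟩
    have h1 : ‖z‖ < 1 := h
    obtain ⟨b, hb⟩ := (PadicInt.norm_lt_one_iff_dvd _).mp h1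
    exact ⟨b, congrArg Subtype.val hb⟩

theorem mem_maxIdeal_iff {α : ℤ_[p]} {f : IntZLoc p} :
    f ∈ maxIdeal p α ↔ ‖aeval (α : ℚ_[p]) (f : ℚ[X])‖ < 1 :=
  exists_eq_p_mul_iff

/-! ### Density of integer-valued polynomials and denominators -/

/-- The binomial polynomial `X (X - 1) ⋯ (X - n + 1) / n!`. -/
noncomputable def binomialPoly (n : ℕ) : ℚ[X] := C ((n.factorial : ℚ)⁻¹) * descPochhammer ℚ n

theorem eval_natCast_binomialPoly (n m : ℕ) : (binomialPoly n).eval (m : ℚ) = m.choose n := by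
  have : (n.factorial : ℚ) ≠ 0 := mod_cast n.factorial_ne_zero
  rw [binomialPoly, eval_mul, eval_C, descPochhammer_eval_eq_descFactorial,
    Nat.descFactorial_eq_factorial_mul_choose]
  push_cast
  field_simp

theorem aeval_binomialPoly (n : ℕ) (α : ℤ_[p]) :
    aeval (α : ℚ_[p]) (binomialPoly n) = (mahler n α : ℤ_[p]) := by
  refine congrFun (PadicInt.denseRange_natCast.equalizer (continuous_aeval_coe (binomialPoly n))
    (continuous_subtype_val.comp (mahler n).continuous) ?_) α
  funext m
  have := aeval_algebraMap_apply_eq_algebraMap_eval (A := ℚ_[p]) (m : ℚ) (binomialPoly n)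
  rw [eval_natCast_binomialPoly] at this
  change aeval ((m : ℤ_[p]) : ℚ_[p]) _ = ((mahler n (m : ℤ_[p]) : ℤ_[p]) : ℚ_[p])
  rw [mahler_natCast_eq]
  simpa using this

/-- `Int(ℤ_(p))` is dense in the space of continuous functions `ℤ_p → ℤ_p`. -/
theorem exists_mem_IntZLoc_norm_sub_lt (g : C(ℤ_[p], ℤ_[p])) {ε : ℝ} (hε : 0 < ε) :
    ∃ h ∈ IntZLoc p, ∀ α : ℤ_[p], ‖aeval (α : ℚ_[p]) h - g α‖ < ε := by
  obtain ⟨s, hs⟩ := ((PadicInt.hasSum_mahler g).eventually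
    (Metric.ball_mem_nhds g hε)).exists
  replace hs := (dist_eq_norm _ _).symm.trans_lt hs
  set a : ℕ → ℤ_[p] := fun n => (fwdDiff 1)^[n] g 0
  -- Mahler coefficients lie in `ℤ_p`; natural number approximations make the polynomial rational.
  have hc : ∀ n, ∃ c : ℕ, ‖a n - c‖ < ε := fun n => by
    obtain ⟨c, hc⟩ := PadicInt.denseRange_natCast.exists_dist_lt (a n) hε
    exact ⟨c, by rwa [← dist_eq_norm]⟩
  choose c hc using hc
  have hval : ∀ α : ℤ_[p], aeval (α : ℚ_[p]) (∑ n ∈ s, (c n : ℚ[X]) * binomialPoly n)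
      = ((∑ n ∈ s, c n * mahler n α : ℤ_[p]) : ℚ_[p]) := fun α => by
    simp [aeval_binomialPoly, PadicInt.coe_sum]
  refine ⟨∑ n ∈ s, (c n : ℚ[X]) * binomialPoly n, mem_IntZLoc_iff.mpr fun α => ?_, fun α => ?_⟩
  · rw [hval]
    exact PadicInt.norm_le_one _
  · rw [hval, ← PadicInt.coe_sub, ← PadicInt.norm_def]
    have h1 : ‖∑ n ∈ s, mahler n α * a n - g α‖ < ε := by
      refine lt_of_le_of_lt ?_ hs
      have := (∑ n ∈ s, PadicInt.mahlerTerm (a n) n - g).norm_coe_le_norm α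
      simpa [PadicInt.mahlerTerm_apply] using this
    have h2 : ‖∑ n ∈ s, (c n - a n) * mahler n α‖ < ε := by
      obtain rfl | hne := s.eq_empty_or_nonempty
      · simpa using hε
      · obtain ⟨i, -, hi⟩ := IsUltrametricDist.exists_norm_finsetSum_le s
          fun n => (c n - a n) * mahler n α
        refine hi.trans_lt ?_
        rw [norm_mul]
        refine (mul_le_of_le_one_right (norm_nonneg _) (PadicInt.norm_le_one _)).trans_lt ?_
        rw [norm_sub_rev]
        exact hc i
    have h3 : ∑ n ∈ s, c n * mahler n α - g α
        = ∑ n ∈ s, (c n - a n) * mahler n α + (∑ n ∈ s, mahler n α * a n - g α) := by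
      simp only [sub_mul, Finset.sum_sub_distrib, mul_comm (a _)]
      ring
    rw [h3]
    exact (PadicInt.nonarchimedean _ _).trans_lt (max_lt h2 h1)

theorem exists_norm_aeval_le (f : ℚ[X]) :
    ∃ m : ℕ, ∀ α : ℤ_[p], ‖(p : ℚ_[p]) ^ m * aeval (α : ℚ_[p]) f‖ ≤ 1 := by
  obtain ⟨C, hC⟩ := (isCompact_range (continuous_aeval_coe (p := p) f)).isBounded.exists_norm_le
  have hC' : 0 < max C 1 := lt_max_of_lt_right one_pos
  obtain ⟨m, hm⟩ := PadicInt.exists_pow_neg_lt p (inv_pos.mpr hC')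
  refine ⟨m, fun α => ?_⟩
  have h1 : ‖aeval (α : ℚ_[p]) f‖ ≤ max C 1 := (hC _ ⟨α, rfl⟩).trans (le_max_left _ _)
  rw [norm_mul, Padic.norm_p_pow]
  calc _ ≤ (max C 1)⁻¹ * max C 1 := by gcongr
    _ = 1 := inv_mul_cancel₀ hC'.ne'

/-- The closed unit ball is clopen, so the two branches need not agree on any boundary, and `0`
stays away from the inverse. -/
theorem continuous_ite_norm_le_one_inv :
    Continuous fun y : ℚ_[p] => if ‖y‖ ≤ 1 then 1 else y⁻¹ := by
  refine continuous_iff_continuousAt.mpr fun y => ?_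
  have hcl : IsClopen {y : ℚ_[p] | ‖y‖ ≤ 1} := by
    have := IsUltrametricDist.isClopen_closedBall (0 : ℚ_[p]) one_ne_zero
    simpa [Metric.closedBall, dist_zero_right] using this
  by_cases hy : ‖y‖ ≤ 1
  · refine (continuousAt_const (y := (1 : ℚ_[p]))).congr ?_
    filter_upwards [hcl.isOpen.mem_nhds hy] with z hz
    exact (if_pos hz).symm
  · have hy0 : y ≠ 0 := by rintro rfl; simp at hy
    refine (continuousAt_inv₀ hy0).congr ?_
    filter_upwards [hcl.compl.isOpen.mem_nhds hy] with z hz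
    exact (if_neg hz).symm

/-- Every `f ∈ ℚ[X]` has an integer-valued denominator `h` of exactly the size needed at each
point of `ℤ_p`. -/
theorem exists_mem_IntZLoc_norm_eq (f : ℚ[X]) :
    ∃ h ∈ IntZLoc p, ∀ α : ℤ_[p], ‖aeval (α : ℚ_[p]) h‖ =
      if ‖aeval (α : ℚ_[p]) f‖ ≤ 1 then 1 else ‖aeval (α : ℚ_[p]) f‖⁻¹ := by
  set G : ℚ_[p] → ℚ_[p] := fun y => if ‖y‖ ≤ 1 then 1 else y⁻¹ with hG
  have hnorm : ∀ y, ‖G y‖ = if ‖y‖ ≤ 1 then 1 else ‖y‖⁻¹ := fun y => by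
    simp only [hG]; split_ifs <;> simp
  have hG1 : ∀ y, ‖G y‖ ≤ 1 := fun y => by
    rw [hnorm]; split_ifs with hy
    · exact le_rfl
    · exact inv_le_one_of_one_le₀ (not_le.mp hy).le
  let g : C(ℤ_[p], ℤ_[p]) := ⟨fun α => ⟨G (aeval (α : ℚ_[p]) f), hG1 _⟩,
    (continuous_ite_norm_le_one_inv.comp (continuous_aeval_coe f)).subtype_mk _⟩
  obtain ⟨m, hm⟩ := exists_norm_aeval_le (p := p) f
  have hpm : 0 < ‖(p : ℚ_[p]) ^ m‖ :=
    norm_pos_iff.mpr (pow_ne_zero _ (mod_cast hp.out.ne_zero))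
  obtain ⟨h, hh, hlt⟩ := exists_mem_IntZLoc_norm_sub_lt g hpm
  -- The error is below `|p^m|`, which is at most `|g α|` for every `α`, so the ultrametric
  -- inequality gives `|h(α)| = |g α|`.
  refine ⟨h, hh, fun α => ?_⟩
  rw [← hnorm]
  refine Padic.norm_eq_of_norm_sub_lt_right ((hlt α).trans_le ?_)
  rw [hnorm]
  split_ifs with hy
  · rw [norm_pow]
    exact pow_le_one₀ (norm_nonneg _) (by simpa using Padic.norm_int_le_one (p := p) p)
  · rw [← one_div, le_div_iff₀ (one_pos.trans (not_le.mp hy)), ← norm_mul]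
    exact hm α

/-! ### Integrality on `Zp p R` -/

/-- An ideal containing the extension of `𝔐_{p,α}` and an integer-valued polynomial which is a unit
at `α` is the unit ideal. -/
theorem eq_top_of_norm_eq_one {R : PolyOverring p} {α : ℤ_[p]} {J : Ideal R.1}
    (hJ : (maxIdeal p α).map (Subring.inclusion R.2) ≤ J) {h : IntZLoc p}
    (hhJ : Subring.inclusion R.2 h ∈ J) (hα : ‖aeval (α : ℚ_[p]) (h : ℚ[X])‖ = 1) : J = ⊤ := by
  set y := aeval (α : ℚ_[p]) (h : ℚ[X])
  have hy0 : y ≠ 0 := norm_pos_iff.mp (hα ▸ one_pos)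
  let z : ℤ_[p] := ⟨y⁻¹, by rw [norm_inv, hα, inv_one]⟩
  -- `n` inverts `h(α)` modulo `p`, so `1 - n h` lies in `𝔐_{p,α}`.
  obtain ⟨n, hn⟩ := PadicInt.denseRange_natCast.exists_dist_lt z one_pos
  have hmem : 1 - (n : IntZLoc p) * h ∈ maxIdeal p α := by
    rw [mem_maxIdeal_iff]
    have h1 : aeval (α : ℚ_[p]) ((1 - (n : IntZLoc p) * h : IntZLoc p) : ℚ[X])
        = (y⁻¹ - n) * y := by
      rw [sub_mul, inv_mul_cancel₀ hy0]
      simp [y]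
    rw [h1, norm_mul, hα, mul_one]
    rwa [dist_eq_norm, PadicInt.norm_def, PadicInt.coe_sub] at hn
  have h2 := hJ (Ideal.mem_map_of_mem (Subring.inclusion R.2) hmem)
  refine (Ideal.eq_top_iff_one _).mpr ?_
  have h3 := J.add_mem h2 (J.mul_mem_left (Subring.inclusion R.2 n) hhJ)
  rwa [← map_mul, ← map_add, sub_add_cancel, map_one] at h3

theorem norm_aeval_le_one_of_mem_Zp {R : PolyOverring p} {α : ℤ_[p]} (hα : α ∈ Zp p R)
    {f : ℚ[X]} (hf : f ∈ R.1) : ‖aeval (α : ℚ_[p]) f‖ ≤ 1 := by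
  by_contra hlt
  obtain ⟨h, hh, hnorm⟩ := exists_mem_IntZLoc_norm_eq (p := p) f
  have hprod : ∀ β : ℤ_[p], ‖aeval (β : ℚ_[p]) (h * f)‖ ≤ 1 := fun β => by
    rw [map_mul, norm_mul, hnorm]
    split_ifs with hβ
    · rwa [one_mul]
    · exact inv_mul_le_one
  have hhα : (⟨h, hh⟩ : IntZLoc p) ∈ maxIdeal p α := by
    rw [mem_maxIdeal_iff, hnorm, if_neg hlt]
    exact inv_lt_one_of_one_lt₀ (not_le.mp hlt)
  have hmul : Subring.inclusion R.2 ⟨h * f, mem_IntZLoc_iff.mpr hprod⟩ =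
      Subring.inclusion R.2 ⟨h, hh⟩ * ⟨f, hf⟩ := Subtype.ext rfl
  refine hα.ne (eq_top_of_norm_eq_one (h := ⟨h * f, mem_IntZLoc_iff.mpr hprod⟩) le_rfl ?_ ?_)
  · rw [hmul]
    exact Ideal.mul_mem_right _ _ (Ideal.mem_map_of_mem (Subring.inclusion R.2) hhα)
  · rw [map_mul, norm_mul, hnorm, if_neg hlt]
    exact inv_mul_cancel₀ (one_pos.trans (not_le.mp hlt)).ne'

theorem mem_Zp_iff {R : PolyOverring p} {α : ℤ_[p]} :
    α ∈ Zp p R ↔ ∀ f ∈ R.1, ‖aeval (α : ℚ_[p]) f‖ ≤ 1 := by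
  refine ⟨fun hα f hf => norm_aeval_le_one_of_mem_Zp hα hf, fun h => ?_⟩
  let ev : R.1 →+* PadicInt.subring p :=
    ((aeval (α : ℚ_[p]) : ℚ[X] →ₐ[ℚ] ℚ_[p]).toRingHom.comp R.1.subtype).codRestrict
      (PadicInt.subring p) fun f => h f f.2
  let ev' : R.1 →+* ℤ_[p] := ev
  refine lt_of_le_of_lt (b := (IsLocalRing.maximalIdeal ℤ_[p]).comap ev') ?_
    (lt_top_iff_ne_top.mpr (Ideal.comap_ne_top _ (Ideal.IsPrime.ne_top inferInstance)))
  refine Ideal.map_le_iff_le_comap.mpr fun f hf => ?_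
  rw [Ideal.mem_comap, Ideal.mem_comap, IsLocalRing.mem_maximalIdeal, PadicInt.mem_nonunits]
  exact mem_maxIdeal_iff.mp hf

theorem isClosed_Zp (R : PolyOverring p) : IsClosed (Zp p R) := by
  have : Zp p R = ⋂ f ∈ R.1, {α : ℤ_[p] | ‖aeval (α : ℚ_[p]) f‖ ≤ 1} := by
    ext α
    simp [mem_Zp_iff]
  rw [this]
  exact isClosed_biInter fun f _ => isClosed_le (continuous_aeval_coe f).norm continuous_const

/-- Every prime ideal of `Int(ℤ_(p))` above `p` contains some `𝔐_{p,α}`. -/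
theorem exists_maxIdeal_le (P : Ideal (IntZLoc p)) [P.IsPrime] (hpP : (p : IntZLoc p) ∈ P) :
    ∃ α : ℤ_[p], maxIdeal p α ≤ P := by
  by_contra! hne
  choose g hgm hgP using fun α => SetLike.not_le_iff_exists.mp (hne α)
  -- By compactness a finite product of the `g α` takes values in `pℤ_p` everywhere, hence is `p`
  -- times an integer-valued polynomial and lies in `P`, although no factor does.
  obtain ⟨t, ht⟩ := CompactSpace.elim_nhds_subcover
    (fun α => {β : ℤ_[p] | ‖aeval (β : ℚ_[p]) (g α : ℚ[X])‖ < 1}) fun α =>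
      (isOpen_lt (continuous_aeval_coe _).norm continuous_const).mem_nhds
        (mem_maxIdeal_iff.mp (hgm α))
  have hlt : ∀ β : ℤ_[p], ∏ α ∈ t, g α ∈ maxIdeal p β := fun β => by
    obtain ⟨α, hαt, hα⟩ : ∃ α ∈ t, ‖aeval (β : ℚ_[p]) (g α : ℚ[X])‖ < 1 := by
      have : β ∈ (⊤ : Set ℤ_[p]) := trivial
      rw [← ht] at this
      simpa using this
    exact Ideal.mem_of_dvd _ (Finset.dvd_prod_of_mem g hαt) (mem_maxIdeal_iff.mpr hα)
  have hp0 : (p : ℚ_[p]) ≠ 0 := mod_cast hp.out.ne_zero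
  have hq : C (p : ℚ)⁻¹ * ((∏ α ∈ t, g α : IntZLoc p) : ℚ[X]) ∈ IntZLoc p := by
    refine mem_IntZLoc_iff.mpr fun β => ?_
    obtain ⟨b, hb⟩ := hlt β
    rw [map_mul, hb, aeval_C, map_inv₀, map_natCast, inv_mul_cancel_left₀ hp0]
    exact b.2
  have hmem : ∏ α ∈ t, g α ∈ P := by
    have : ∏ α ∈ t, g α = (p : IntZLoc p) * ⟨_, hq⟩ := by
      ext1
      have hp' : (p : ℚ) ≠ 0 := mod_cast hp.out.ne_zero
      rw [Subring.coe_mul, Subring.coe_natCast, ← mul_assoc, ← C_eq_natCast, ← C_mul,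
        mul_inv_cancel₀ hp', C_1, one_mul]
    rw [this]
    exact P.mul_mem_right _ hpP
  obtain ⟨α, -, hα⟩ := Ideal.IsPrime.prod_mem_iff.mp hmem
  exact hgP α hα

/-! ### Recovering the ring and the closed set -/

/-- The conductor ideal `{r ∈ R | r f ∈ R}`. -/
def conductorIdeal (R : Subring ℚ[X]) (f : ℚ[X]) : Ideal R where
  carrier := {r | (r : ℚ[X]) * f ∈ R}
  zero_mem' := by simp [zero_mem]
  add_mem' {a b} ha hb := by
    simpa [add_mul] using add_mem ha hb
  smul_mem' c r hr := by
    simpa [mul_assoc] using mul_mem c.2 hr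

theorem mem_conductorIdeal {R : Subring ℚ[X]} {f : ℚ[X]} {r : R} :
    r ∈ conductorIdeal R f ↔ (r : ℚ[X]) * f ∈ R := Iff.rfl

/-- A maximal ideal `M` over a proper conductor of `f` contains `p`, since some `p^m f` is
integer-valued. Hence `M` contains some `𝔐_{p,α}`, so `α ∈ Zp p R`. The denominator `h` of `f` lies
in the conductor and is a unit at `α`, so `M` would be the unit ideal. -/
theorem mem_of_norm_aeval_le_one {R : PolyOverring p} {f : ℚ[X]}
    (hf : ∀ α ∈ Zp p R, ‖aeval (α : ℚ_[p]) f‖ ≤ 1) : f ∈ R.1 := by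
  suffices h : conductorIdeal R.1 f = ⊤ by
    simpa [mem_conductorIdeal] using (Ideal.eq_top_iff_one _).mp h
  by_contra hne
  obtain ⟨M, hM, hJM⟩ := Ideal.exists_le_maximal _ hne
  have hpM : (p : R.1) ∈ M := by
    obtain ⟨m, hm⟩ := exists_norm_aeval_le (p := p) f
    refine hM.isPrime.mem_of_pow_mem m (hJM (mem_conductorIdeal.mpr (R.2 ?_)))
    refine mem_IntZLoc_iff.mpr fun α => ?_
    simpa using hm α
  have : (M.comap (Subring.inclusion R.2)).IsPrime := hM.isPrime.comap _
  obtain ⟨α, hα⟩ := exists_maxIdeal_le (M.comap (Subring.inclusion R.2))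
    (by rwa [Ideal.mem_comap, map_natCast])
  have hle := Ideal.map_le_iff_le_comap.mpr hα
  have hαZ : α ∈ Zp p R := hle.trans_lt (lt_top_iff_ne_top.mpr hM.ne_top)
  obtain ⟨h, hh, hnorm⟩ := exists_mem_IntZLoc_norm_eq (p := p) f
  refine hM.ne_top (eq_top_of_norm_eq_one (h := ⟨h, hh⟩) hle (hJM ?_) ?_)
  · refine mem_conductorIdeal.mpr (R.2 (mem_IntZLoc_iff.mpr fun β => ?_))
    change ‖aeval (β : ℚ_[p]) (h * f)‖ ≤ 1
    rw [map_mul, norm_mul, hnorm]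
    split_ifs with hβ
    · rwa [one_mul]
    · exact inv_mul_le_one
  · rw [hnorm, if_pos (hf α hαZ)]

theorem mem_IntQ_iff {E : Set ℤ_[p]} {f : ℚ[X]} :
    f ∈ IntQ p E ↔ ∀ α ∈ E, ‖aeval (α : ℚ_[p]) f‖ ≤ 1 := Iff.rfl

theorem IntZLoc_le_IntQ (E : Set ℤ_[p]) : IntZLoc p ≤ IntQ p E :=
  fun _ hf α _ => norm_aeval_le_one p hf α

theorem eq_IntQ_Zp (R : PolyOverring p) : R.1 = IntQ p (Zp p R) :=
  le_antisymm (fun _ hf _ hα => norm_aeval_le_one_of_mem_Zp hα hf)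
    fun _ hf => mem_of_norm_aeval_le_one hf

theorem exists_mem_IntQ_one_lt {F : Set ℤ_[p]} (hF : IsClosed F) {α : ℤ_[p]} (hα : α ∉ F) :
    ∃ f ∈ IntQ p F, 1 < ‖aeval (α : ℚ_[p]) f‖ := by
  obtain ⟨r, hr, hball⟩ := Metric.isOpen_iff.mp hF.isOpen_compl α hα
  have hcl : IsClopen (Metric.ball α r) := IsUltrametricDist.isClopen_ball α r
  let g : C(ℤ_[p], ℤ_[p]) :=
    ⟨(Metric.ball α r).indicator 1, continuous_one.indicator (by simp [hcl.frontier_eq])⟩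
  -- Precision `1` fixes values modulo `p`: `h` is in `pℤ_p` on `F` and a unit at `α`, so `h / p`
  -- separates them.
  obtain ⟨h, -, hlt⟩ := exists_mem_IntZLoc_norm_sub_lt g one_pos
  have hp0 : (p : ℚ_[p]) ≠ 0 := mod_cast hp.out.ne_zero
  refine ⟨C (p : ℚ)⁻¹ * h, fun β hβ => ?_, ?_⟩
  · have hg : g β = 0 := Set.indicator_of_notMem (fun hb => hball hb hβ) _
    have := hlt β
    rw [hg, PadicInt.coe_zero, sub_zero, ← exists_eq_p_mul_iff] at this
    obtain ⟨b, hb⟩ := this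
    rw [map_mul, hb, aeval_C, map_inv₀, map_natCast, inv_mul_cancel_left₀ hp0]
    exact b.2
  · have hg : g α = 1 := Set.indicator_of_mem (Metric.mem_ball_self hr) _
    have := hlt α
    rw [hg, PadicInt.coe_one] at this
    have h1 : ‖aeval (α : ℚ_[p]) h‖ = 1 := by
      rw [Padic.norm_eq_of_norm_sub_lt_right (z2 := 1) (by simpa using this), norm_one]
    rw [map_mul, norm_mul, h1, mul_one, aeval_C, map_inv₀, map_natCast, norm_inv, Padic.norm_p,
      inv_inv]
    exact_mod_cast hp.out.one_lt

theorem Zp_IntQ {F : Set ℤ_[p]} (hF : IsClosed F) : Zp p ⟨IntQ p F, IntZLoc_le_IntQ F⟩ = F := by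
  ext α
  rw [mem_Zp_iff]
  refine ⟨fun h => ?_, fun hα f hf => hf α hα⟩
  by_contra hα
  obtain ⟨f, hf, hlt⟩ := exists_mem_IntQ_one_lt hF hα
  exact (h f hf).not_gt hlt

end PadicIntPoly

theorem theorem3p9 (p : ℕ) [Fact p.Prime] :
    ∃ (φ : PadicIntPoly.PolyOverring p → TopologicalSpace.Closeds ℤ_[p])
      (ψ : TopologicalSpace.Closeds ℤ_[p] → PadicIntPoly.PolyOverring p),
      (∀ R, (φ R : Set ℤ_[p]) = PadicIntPoly.Zp p R) ∧
      (∀ F, (ψ F : Subring (Polynomial ℚ)) = PadicIntPoly.IntQ p (F : Set ℤ_[p])) ∧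
      Antitone φ ∧ Antitone ψ ∧
      Function.LeftInverse ψ φ ∧ Function.RightInverse ψ φ ∧
      (∀ R : PadicIntPoly.PolyOverring p,
        (R : Subring (Polynomial ℚ)) = PadicIntPoly.IntQ p (PadicIntPoly.Zp p R)) := by
  refine ⟨fun R => ⟨PadicIntPoly.Zp p R, PadicIntPoly.isClosed_Zp R⟩,
    fun F => ⟨PadicIntPoly.IntQ p F, PadicIntPoly.IntZLoc_le_IntQ _⟩,
    fun _ => rfl, fun _ => rfl, fun R S hRS α hα => ?_, fun F G hFG f hf α hα => hf α (hFG hα),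
    fun R => Subtype.ext (PadicIntPoly.eq_IntQ_Zp R).symm,
    fun F => TopologicalSpace.Closeds.ext (PadicIntPoly.Zp_IntQ F.isClosed),
    PadicIntPoly.eq_IntQ_Zp⟩
  exact PadicIntPoly.mem_Zp_iff.mpr fun f hf => PadicIntPoly.mem_Zp_iff.mp hα f (hRS hf)
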